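/- For a metric space $M$ with a base point $0\in M$, let $Lip_0(M)$ be the Banach space of all Lipschitz functions $f:M\to\mathbb{R}$ with $f(0)=0$, normed by $\|f\|_{Lip}=\sup_{x\neq y}\frac{|f(x)-f(y)|}{d(x,y)}$ (with $\|f\|_{Lip}=0$ if $M$ is a single point). The Lipschitz-free space $\mathcal{F}(M)$ is the norm closure in the dual space $Lip_0(M)^*$ of the linear span of the evaluation functionals $\delta_x:f\mapsto f(x)$, $x\in M$. Theorem 3.1. Let $X$ be a real Banach space, with its origin as base point. Then $\mathcal{F}(X)$ is isomorphic (that is, there is a bounded linear bijection with bounded inverse) to its infinite $\ell_1$-sum $$\Big(\sum_{n=1}^\infty \mathcal{F}(X)\Big)_{\ell_1}=\Big\{(\gamma_n)_{n\ge 1}:\gamma_n\in\mathcal{F}(X),\ \sum_{n=1}^\infty\|\gamma_n\|<\infty\Big\},\qquad \|(\gamma_n)\|=\sum_{n=1}^\infty\|\gamma_n\|.$$ -/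

import Mathlib

noncomputable section

/-- The real vector space of all Lipschitz functions `f : M → ℝ` on the metric space `M` that
vanish at the base point `o`. -/
def lipZeroSubmodule (M : Type*) [MetricSpace M] (o : M) : Submodule ℝ (M → ℝ) where
  carrier := {f | (∃ K : NNReal, LipschitzWith K f) ∧ f o = 0}
  add_mem' := by
    rintro f g ⟨⟨K, hf⟩, hf0⟩ ⟨⟨L, hg⟩, hg0⟩
    exact ⟨⟨K + L, hf.add hg⟩, by simp [hf0, hg0]⟩
  zero_mem' := ⟨⟨0, LipschitzWith.const 0⟩, rfl⟩
  smul_mem' := by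
    rintro c f ⟨⟨K, hf⟩, hf0⟩
    refine ⟨⟨‖c‖₊ * K, LipschitzWith.of_dist_le_mul fun x y => ?_⟩, by simp [hf0]⟩
    have h := hf.dist_le_mul x y
    simp only [Pi.smul_apply, dist_smul₀, NNReal.coe_mul, coe_nnnorm, mul_assoc]
    exact mul_le_mul_of_nonneg_left h (norm_nonneg c)

/-- `LipZero M o` is the space `Lip₀(M)` of the pointed metric space `(M, o)`, as a type of its own
(so that its only topology is the one of the Lipschitz norm below). -/
def LipZero (M : Type*) [MetricSpace M] (o : M) : Type _ := lipZeroSubmodule M o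

namespace LipZero

variable {M : Type*} [MetricSpace M] {o : M}

instance : AddCommGroup (LipZero M o) := inferInstanceAs (AddCommGroup (lipZeroSubmodule M o))

instance : Module ℝ (LipZero M o) := inferInstanceAs (Module ℝ (lipZeroSubmodule M o))

instance : FunLike (LipZero M o) M ℝ where
  coe f := f.1
  coe_injective := Subtype.val_injective

theorem ext {f g : LipZero M o} (h : ∀ x, f x = g x) : f = g := DFunLike.ext f g h

theorem zero_apply (x : M) : (0 : LipZero M o) x = 0 := rfl

theorem add_apply (f g : LipZero M o) (x : M) : (f + g) x = f x + g x := rfl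

theorem neg_apply (f : LipZero M o) (x : M) : (-f) x = -f x := rfl

theorem smul_apply (c : ℝ) (f : LipZero M o) (x : M) : (c • f) x = c * f x := rfl

theorem exists_lipschitzWith (f : LipZero M o) : ∃ K : NNReal, LipschitzWith K f := f.2.1

theorem map_base (f : LipZero M o) : f o = 0 := f.2.2

/-- The Lipschitz norm `‖f‖ = sup_{x ≠ y} |f x - f y| / d(x, y)`. The pairs with `x = y` contribute
`0 / 0 = 0`, which changes nothing, and gives the value `0` when `M` is a single point. -/
instance : Norm (LipZero M o) where
  norm f := ⨆ p : M × M, |f p.1 - f p.2| / dist p.1 p.2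

theorem norm_def (f : LipZero M o) : ‖f‖ = ⨆ p : M × M, |f p.1 - f p.2| / dist p.1 p.2 := rfl

theorem bddAbove_range (f : LipZero M o) :
    BddAbove (Set.range fun p : M × M => |f p.1 - f p.2| / dist p.1 p.2) := by
  obtain ⟨K, hK⟩ := f.exists_lipschitzWith
  refine ⟨K, ?_⟩
  rintro _ ⟨p, rfl⟩
  exact div_le_of_le_mul₀ dist_nonneg K.2 (by simpa [Real.dist_eq] using hK.dist_le_mul p.1 p.2)

theorem norm_nonneg' (f : LipZero M o) : 0 ≤ ‖f‖ :=
  Real.iSup_nonneg fun _ => div_nonneg (abs_nonneg _) dist_nonneg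

theorem abs_sub_le (f : LipZero M o) (x y : M) : |f x - f y| ≤ ‖f‖ * dist x y := by
  rcases eq_or_ne x y with rfl | h
  · simp
  · rw [← div_le_iff₀ (dist_pos.2 h)]
    exact le_ciSup f.bddAbove_range (x, y)

theorem norm_le {f : LipZero M o} {C : ℝ} (hC : 0 ≤ C)
    (h : ∀ x y, |f x - f y| ≤ C * dist x y) : ‖f‖ ≤ C :=
  Real.iSup_le (fun p => div_le_of_le_mul₀ dist_nonneg hC (h p.1 p.2)) hC

theorem abs_apply_le (f : LipZero M o) (x : M) : |f x| ≤ dist x o * ‖f‖ := by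
  simpa [f.map_base, mul_comm] using f.abs_sub_le x o

instance : NormedAddCommGroup (LipZero M o) :=
  AddGroupNorm.toNormedAddCommGroup
    { toFun := fun f => ‖f‖
      map_zero' := le_antisymm (norm_le le_rfl fun x y => by simp [zero_apply]) (norm_nonneg' _)
      add_le' := fun f g => norm_le (add_nonneg f.norm_nonneg' g.norm_nonneg') fun x y => by
        have h : (f + g) x - (f + g) y = (f x - f y) + (g x - g y) := by
          rw [add_apply, add_apply]; ring
        rw [h, add_mul]
        exact (abs_add_le _ _).trans (add_le_add (f.abs_sub_le x y) (g.abs_sub_le x y))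
      neg' := fun f => by
        simp only [norm_def, neg_apply]
        congr 1
        ext p
        rw [← abs_neg]
        congr 2
        ring
      eq_zero_of_map_eq_zero' := fun f hf => ext fun x => by
        have h := f.abs_apply_le x
        rw [show ‖f‖ = 0 from hf, mul_zero] at h
        exact abs_nonpos_iff.1 h }

instance : NormedSpace ℝ (LipZero M o) where
  norm_smul_le c f := norm_le (mul_nonneg (norm_nonneg c) f.norm_nonneg') fun x y => by
    rw [smul_apply, smul_apply, ← mul_sub, abs_mul, mul_assoc, Real.norm_eq_abs]
    exact mul_le_mul_of_nonneg_left (f.abs_sub_le x y) (abs_nonneg c)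

end LipZero

/-- The evaluation functional `δ_x ∈ Lip₀(M)*`, `δ_x(f) = f(x)`. -/
def lipDelta {M : Type*} [MetricSpace M] (o : M) (x : M) : StrongDual ℝ (LipZero M o) :=
  LinearMap.mkContinuous
    { toFun := fun f => f x
      map_add' := fun _ _ => rfl
      map_smul' := fun _ _ => rfl }
    (dist x o) fun f => f.abs_apply_le x

/-- The norm closure, in the dual Banach space `Lip₀(M)*`, of the linear span of the evaluation
functionals. -/
def lipschitzFreeSubmodule (M : Type*) [MetricSpace M] (o : M) :
    Submodule ℝ (StrongDual ℝ (LipZero M o)) :=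
  (Submodule.span ℝ (Set.range (lipDelta (M := M) o))).topologicalClosure

/-- The Lipschitz-free space `F(M)` of the pointed metric space `(M, o)`: the closed linear span of
the evaluation functionals in `Lip₀(M)*`, with the norm of that dual. -/
def LipschitzFree (M : Type*) [MetricSpace M] (o : M) : Type _ := lipschitzFreeSubmodule M o

instance {M : Type*} [MetricSpace M] {o : M} : NormedAddCommGroup (LipschitzFree M o) :=
  inferInstanceAs (NormedAddCommGroup (lipschitzFreeSubmodule M o))

instance {M : Type*} [MetricSpace M] {o : M} : NormedSpace ℝ (LipschitzFree M o) :=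
  inferInstanceAs (NormedSpace ℝ (lipschitzFreeSubmodule M o))

instance {M : Type*} [MetricSpace M] {o : M} : CompleteSpace (LipschitzFree M o) :=
  (Submodule.isClosed_topologicalClosure _).completeSpace_coe

end

/-! By Pełczyński's decomposition it suffices to embed `ℓ₁(F(X))` as a complemented subspace of
`F(X)`. If `E ≅ ℓ₁(E) × K`, then `E × ℓ₁(E) ≅ E`, since `ℓ₁(E)` absorbs a further copy of itself;
and `E × ℓ₁(E) ≅ ℓ₁(E)`.

For the embedding, fix a unit vector `e` and choose, for each copy `n` of `X` and each scale `2 ^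
k`, a ball centred on the line through `e`; these balls are pairwise disjoint and avoid the origin.
A dyadic partition of unity cuts `δ_x` into pieces at the scales near `‖x‖`, and a dilation moves
the piece at scale `2 ^ k` into the ball `(n, k)`. Summed over `k`, this gives the operator `J` on
the `n`-th coordinate. In the other direction, `P` cuts off to each ball and dilates back to the
coordinate it came from. Dilation by `s` is compensated by the factor `s⁻¹` (or `s`), so all pieces
are uniformly Lipschitz. Boundedly many are nonzero at each point, so the sums are Lipschitz and
linearize (`exists_lift`). Since the partition sums to `1`, `P ∘ J = id` (`exists_comp_eq_id`). -/

open Set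
open scoped NNReal

/-! ### Free spaces and the linearization of Lipschitz maps -/

section LipschitzFreeLift

namespace LipschitzFree

variable {M : Type*} [MetricSpace M] {o : M}

/-- The canonical map `M → F(M)`. -/
noncomputable def delta (o x : M) : LipschitzFree M o :=
  ⟨lipDelta o x, Submodule.le_topologicalClosure _ (Submodule.subset_span ⟨x, rfl⟩)⟩

theorem delta_base : delta o o = 0 :=
  Subtype.ext (ContinuousLinearMap.ext fun f => f.map_base)

theorem lipschitzWith_delta : LipschitzWith 1 (delta o) := by
  refine LipschitzWith.of_dist_le_mul fun x y => ?_
  rw [NNReal.coe_one, one_mul, dist_eq_norm]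
  refine ContinuousLinearMap.opNorm_le_bound (lipDelta o x - lipDelta o y) dist_nonneg fun f => ?_
  rw [mul_comm]
  exact f.abs_sub_le x y

theorem dense_span_delta :
    Dense (Submodule.span ℝ (range (delta o)) : Set (LipschitzFree M o)) := by
  have hcoe : (Subtype.val : lipschitzFreeSubmodule M o → _) ''
      (Submodule.span ℝ (range (delta o)) : Set (LipschitzFree M o))
      = Submodule.span ℝ (range (lipDelta o)) := by
    have := Submodule.map_span (lipschitzFreeSubmodule M o).subtype (range (delta o))
    have hr : (lipschitzFreeSubmodule M o).subtype '' range (delta o) = range (lipDelta o) :=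
      (range_comp _ (delta o)).symm
    rw [hr] at this
    exact congrArg SetLike.coe this
  intro γ
  have h : γ.1 ∈ closure (Submodule.span ℝ (range (lipDelta (M := M) o)) : Set _) := γ.2
  rw [← hcoe] at h
  exact ((Topology.IsInducing.subtypeVal
    (t := {γ | γ ∈ lipschitzFreeSubmodule M o})).closure_eq_preimage_closure_image _).symm ▸ h

variable {Z : Type*} [NormedAddCommGroup Z] [NormedSpace ℝ Z]

theorem clm_ext {S T : LipschitzFree M o →L[ℝ] Z} (h : ∀ x, S (delta o x) = T (delta o x)) :
    S = T :=
  ContinuousLinearMap.ext_on dense_span_delta (by rintro _ ⟨x, rfl⟩; exact h x)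

/-- Composition with a Lipschitz map, as an operator between the spaces of functionals. -/
noncomputable def precomp {T : M → Z} {K : ℝ≥0} (hT : LipschitzWith K T) (h0 : T o = 0) :
    StrongDual ℝ Z →L[ℝ] LipZero M o :=
  LinearMap.mkContinuous
    { toFun := fun φ => ⟨φ ∘ T, ⟨_, φ.lipschitz.comp hT⟩, by simp [h0]⟩
      map_add' := fun _ _ => rfl
      map_smul' := fun _ _ => rfl }
    K fun φ => LipZero.norm_le (by positivity) fun x y => by
      have h : |φ (T x) - φ (T y)| ≤ ‖φ‖ * ‖T x - T y‖ := by
        rw [← map_sub]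
        exact φ.le_opNorm _
      have h' := hT.dist_le_mul x y
      rw [dist_eq_norm] at h'
      calc _ ≤ ‖φ‖ * ‖T x - T y‖ := h
        _ ≤ ‖φ‖ * (K * dist x y) := by gcongr
        _ = _ := by ring

/-- The universal property of `F(M)`: Lipschitz maps into Banach spaces that vanish at the base
point linearize. -/
theorem exists_lift [CompleteSpace Z] {T : M → Z} {K : ℝ≥0} (hT : LipschitzWith K T)
    (h0 : T o = 0) :
    ∃ L : LipschitzFree M o →L[ℝ] Z, ‖L‖ ≤ K ∧ ∀ x, L (delta o x) = T x := by
  -- The adjoint of `precomp` sends `δ_x` to the canonical image of `T x` in the bidual. That image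
  -- of `Z` is closed because `Z` is complete, so all of `F(M)` lands in it.
  let ι := NormedSpace.inclusionInDoubleDualLi ℝ (E := Z)
  let A : StrongDual ℝ (LipZero M o) →L[ℝ] StrongDual ℝ (StrongDual ℝ Z) :=
    (ContinuousLinearMap.compL ℝ (StrongDual ℝ Z) (LipZero M o) ℝ).flip (precomp hT h0)
  have hAdelta : ∀ x, A (lipDelta o x) = ι (T x) := fun x => rfl
  have hA : ∀ γ : lipschitzFreeSubmodule M o, A γ.1 ∈ ι.toLinearMap.range := by
    have hclosed : IsClosed (ι.toLinearMap.range : Set (StrongDual ℝ (StrongDual ℝ Z))) := by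
      rw [LinearMap.coe_range]
      exact ι.isometry.isUniformInducing.isComplete_range.isClosed
    have hle : lipschitzFreeSubmodule M o ≤ ι.toLinearMap.range.comap A.toLinearMap := by
      refine Submodule.topologicalClosure_minimal _ ?_ (hclosed.preimage A.continuous)
      rw [Submodule.span_le]
      rintro _ ⟨x, rfl⟩
      exact ⟨T x, (hAdelta x).symm⟩
    exact fun γ => hle γ.2
  let B : lipschitzFreeSubmodule M o →L[ℝ] ι.toLinearMap.range :=
    (A.comp (lipschitzFreeSubmodule M o).subtypeL).codRestrict _ hA
  let e : Z ≃ₗᵢ[ℝ] ι.toLinearMap.range := ι.equivRange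
  let L : lipschitzFreeSubmodule M o →L[ℝ] Z :=
    (e.symm.toContinuousLinearEquiv : _ →L[ℝ] Z).comp B
  refine ⟨L, ?_, fun x => ?_⟩
  · refine ContinuousLinearMap.opNorm_le_bound _ K.2 fun γ => ?_
    have h1 : ‖L γ‖ = ‖γ.1.comp (precomp hT h0)‖ := e.symm.norm_map _
    change ‖L γ‖ ≤ K * ‖γ.1‖
    rw [h1, mul_comm]
    refine (ContinuousLinearMap.opNorm_comp_le _ _).trans ?_
    gcongr
    exact LinearMap.mkContinuous_norm_le _ K.2 _
  · change e.symm (B (delta o x)) = T x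
    rw [LinearIsometryEquiv.symm_apply_eq]
    exact Subtype.ext (hAdelta x)

end LipschitzFree

end LipschitzFreeLift

/-! ### Operators on `ℓ₁`-sums and the decomposition method -/

section EllOne

variable {ι E Z : Type*} [NormedAddCommGroup E] [NormedSpace ℝ E]
  [NormedAddCommGroup Z] [NormedSpace ℝ Z]

namespace lp

theorem summable_norm_of_one {E : Type*} [NormedAddCommGroup E] (a : lp (fun _ : ι => E) 1) : Summable fun i => ‖a i‖ := by
  simpa using (lp.memℓp a).summable (by simp)

theorem norm_eq_tsum_of_one {E : Type*} [NormedAddCommGroup E] (a : lp (fun _ : ι => E) 1) : ‖a‖ = ∑' i, ‖a i‖ := by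
  simpa using lp.norm_eq_tsum_rpow (p := 1) (by simp) a

variable (ι E) in
/-- The inclusion of a coordinate into an `ℓ₁`-sum. -/
abbrev inj [DecidableEq ι] (i : ι) : E →L[ℝ] lp (fun _ : ι => E) 1 :=
  lp.singleContinuousLinearMap ℝ (fun _ : ι => E) 1 i

theorem clm_ext_of_one [DecidableEq ι] {S T : lp (fun _ : ι => E) 1 →L[ℝ] Z}
    (h : ∀ i, S.comp (inj ι E i) = T.comp (inj ι E i)) : S = T := by
  ext a
  have ha := lp.hasSum_single (p := 1) (by simp) a
  refine (ha.mapL S).unique ?_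
  convert ha.mapL T using 2 with i
  exact DFunLike.congr_fun (h i) (a i)

/-- Uniformly bounded families of operators extend to the `ℓ₁`-sum. -/
theorem exists_lift_of_one [DecidableEq ι] [CompleteSpace Z] {T : ι → E →L[ℝ] Z} {C : ℝ}
    (hT : ∀ i, ‖T i‖ ≤ C) :
    ∃ L : lp (fun _ : ι => E) 1 →L[ℝ] Z, ∀ i, L.comp (inj ι E i) = T i := by
  have hle : ∀ (a : lp (fun _ : ι => E) 1) i, ‖T i (a i)‖ ≤ C * ‖a i‖ := fun a i =>
    (T i).le_of_opNorm_le (hT i) _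
  have hs : ∀ a : lp (fun _ : ι => E) 1, Summable fun i => T i (a i) := fun a =>
    Summable.of_norm_bounded ((summable_norm_of_one a).mul_left C) (hle a)
  refine ⟨LinearMap.mkContinuous
    { toFun := fun a => ∑' i, T i (a i)
      map_add' := fun a b => by
        rw [← (hs a).tsum_add (hs b)]
        simp
      map_smul' := fun c a => by
        rw [RingHom.id_apply, ← (hs a).tsum_const_smul c]
        simp } C fun a => ?_, fun i => ?_⟩
  · rw [norm_eq_tsum_of_one, ← tsum_mul_left]
    exact tsum_of_norm_bounded ((summable_norm_of_one a).mul_left C).hasSum (hle a)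
  · ext x
    change ∑' j, T j ((lp.single 1 i x : lp (fun _ : ι => E) 1) j) = T i x
    rw [tsum_eq_single i fun j hj => by rw [lp.single_apply_ne _ _ _ hj, map_zero],
      lp.single_apply_self]

theorem norm_inj_le [DecidableEq ι] (i : ι) : ‖inj ι E i‖ ≤ 1 :=
  ContinuousLinearMap.opNorm_le_bound _ zero_le_one fun x => by
    rw [one_mul]
    exact (lp.norm_single (E := fun _ : ι => E) (by simp) i x).le

variable [CompleteSpace E]

/-- `ℓ₁(E) ≅ ℓ₁(E) × ℓ₁(E)`. -/
theorem nonempty_equiv_prod_self :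
    Nonempty (lp (fun _ : ℕ => E) 1 ≃L[ℝ] lp (fun _ : ℕ => E) 1 × lp (fun _ : ℕ => E) 1) := by
  let W := lp (fun _ : ℕ => E) 1
  let σ : ℕ ⊕ ℕ ≃ ℕ := Equiv.natSumNatEquivNat
  obtain ⟨A, hA⟩ := exists_lift_of_one (T := fun n => inj ℕ E (σ (.inl n))) (C := 1)
    fun n => norm_inj_le _
  obtain ⟨B, hB⟩ := exists_lift_of_one (T := fun n => inj ℕ E (σ (.inr n))) (C := 1)
    fun n => norm_inj_le _
  obtain ⟨D, hD⟩ := exists_lift_of_one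
    (T := fun n => Sum.elim (fun i => (ContinuousLinearMap.inl ℝ W W).comp (inj ℕ E i))
      (fun i => (ContinuousLinearMap.inr ℝ W W).comp (inj ℕ E i)) (σ.symm n)) (C := 1) (by
      intro n
      refine ContinuousLinearMap.opNorm_le_bound _ zero_le_one fun x => ?_
      rcases σ.symm n with i | i
      · refine max_le ((inj ℕ E i).le_of_opNorm_le (norm_inj_le i) x) ?_
        simp
      · refine max_le ?_ ((inj ℕ E i).le_of_opNorm_le (norm_inj_le i) x)
        simp)
  refine ⟨ContinuousLinearEquiv.equivOfInverse' D (A.coprod B) ?_ ?_⟩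
  · have h1 : D.comp A = ContinuousLinearMap.inl ℝ W W := clm_ext_of_one fun i => by
      rw [ContinuousLinearMap.comp_assoc, hA, hD, Equiv.symm_apply_apply, Sum.elim_inl]
    have h2 : D.comp B = ContinuousLinearMap.inr ℝ W W := clm_ext_of_one fun i => by
      rw [ContinuousLinearMap.comp_assoc, hB, hD, Equiv.symm_apply_apply, Sum.elim_inr]
    rw [ContinuousLinearMap.comp_coprod, h1, h2, ContinuousLinearMap.coprod_inl_inr]
  · refine clm_ext_of_one fun n => ?_
    rw [ContinuousLinearMap.comp_assoc, hD, ContinuousLinearMap.id_comp]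
    obtain ⟨i, rfl⟩ := σ.surjective n
    rw [Equiv.symm_apply_apply]
    rcases i with i | i
    · rw [Sum.elim_inl, ← ContinuousLinearMap.comp_assoc, ContinuousLinearMap.coprod_comp_inl, hA]
    · rw [Sum.elim_inr, ← ContinuousLinearMap.comp_assoc, ContinuousLinearMap.coprod_comp_inr, hB]

/-- `ℓ₁(E) ≅ E × ℓ₁(E)`. -/
theorem nonempty_equiv_prod :
    Nonempty (lp (fun _ : ℕ => E) 1 ≃L[ℝ] E × lp (fun _ : ℕ => E) 1) := by
  let W := lp (fun _ : ℕ => E) 1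
  obtain ⟨B, hB⟩ := exists_lift_of_one (T := fun n => inj ℕ E (n + 1)) (C := 1)
    fun n => norm_inj_le _
  obtain ⟨D, hD⟩ := exists_lift_of_one
    (T := fun n => Nat.casesOn (motive := fun _ => E →L[ℝ] E × W) n
      (ContinuousLinearMap.inl ℝ E W) fun i => (ContinuousLinearMap.inr ℝ E W).comp (inj ℕ E i))
    (C := 1) (by
      intro n
      refine ContinuousLinearMap.opNorm_le_bound _ zero_le_one fun x => ?_
      rcases n with _ | i
      · simp [Prod.norm_def]
      · simpa [Prod.norm_def, -lp.singleContinuousLinearMap_apply] using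
          (inj ℕ E i).le_of_opNorm_le (norm_inj_le i) x)
  refine ⟨ContinuousLinearEquiv.equivOfInverse' D ((inj ℕ E 0).coprod B) ?_ ?_⟩
  · have h2 : D.comp B = ContinuousLinearMap.inr ℝ E W := clm_ext_of_one fun i => by
      rw [ContinuousLinearMap.comp_assoc, hB, hD]
    rw [ContinuousLinearMap.comp_coprod, hD 0, h2]
    exact ContinuousLinearMap.coprod_inl_inr
  · refine clm_ext_of_one fun n => ?_
    rw [ContinuousLinearMap.comp_assoc, hD, ContinuousLinearMap.id_comp]
    rcases n with _ | i
    · exact ContinuousLinearMap.coprod_comp_inl _ _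
    · dsimp only
      rw [← ContinuousLinearMap.comp_assoc, ContinuousLinearMap.coprod_comp_inr, hB]

/-- The Pełczyński decomposition argument: if `ℓ₁(E)` is isomorphic to a complemented subspace
of `E`, then `E ≅ ℓ₁(E)`. -/
theorem nonempty_equiv_of_complemented (P : E →L[ℝ] lp (fun _ : ℕ => E) 1)
    (J : lp (fun _ : ℕ => E) 1 →L[ℝ] E) (h : P.comp J = ContinuousLinearMap.id ℝ _) :
    Nonempty (E ≃L[ℝ] lp (fun _ : ℕ => E) 1) := by
  let W := lp (fun _ : ℕ => E) 1
  obtain ⟨e⟩ := nonempty_equiv_prod_self (E := E)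
  obtain ⟨f⟩ := nonempty_equiv_prod (E := E)
  let g : E ≃L[ℝ] W × P.ker :=
    ContinuousLinearEquiv.equivOfRightInverse P J (DFunLike.congr_fun h)
  -- With `K = ker P`: `E × W ≅ W × (W × K) ≅ (W × W) × K ≅ W × K ≅ E`.
  let r : (E × W) ≃L[ℝ] E :=
    (ContinuousLinearEquiv.prodComm ℝ E W).trans <|
    ((ContinuousLinearEquiv.refl ℝ W).prodCongr g).trans <|
    (ContinuousLinearEquiv.prodAssoc ℝ W W P.ker).symm.trans <|
    (e.symm.prodCongr (ContinuousLinearEquiv.refl ℝ P.ker)).trans g.symm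
  exact ⟨(f.trans r).symm⟩

end lp

end EllOne

/-! ### Lipschitz bounds for localized maps and their sums -/

section LipschitzSums

open scoped Classical in
/-- The sum of a family of `C`-Lipschitz maps, at most `N` of which are nonzero at each point, is
`2NC`-Lipschitz. -/
theorem LipschitzWith.finsum_of_card_support_le {ι X Z : Type*} [PseudoMetricSpace X]
    [SeminormedAddCommGroup Z] {u : ι → X → Z} {C : ℝ≥0} {N : ℕ}
    (hu : ∀ i, LipschitzWith C (u i))
    (hS : ∀ x, ∃ S : Finset ι, S.card ≤ N ∧ ∀ i, u i x ≠ 0 → i ∈ S) :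
    LipschitzWith (2 * N * C) fun x => ∑ᶠ i, u i x := by
  refine LipschitzWith.of_dist_le_mul fun x y => ?_
  obtain ⟨S, hSN, hS'⟩ := hS x
  obtain ⟨S', hSN', hS''⟩ := hS y
  -- Both sums run over one index set of at most `2N` elements, and each index contributes at most
  -- `C * dist x y`.
  have hx : ∑ᶠ i, u i x = ∑ i ∈ S ∪ S', u i x :=
    finsum_eq_sum_of_support_subset _ fun i hi =>
      Finset.mem_coe.2 (Finset.mem_union_left _ (hS' i hi))
  have hy : ∑ᶠ i, u i y = ∑ i ∈ S ∪ S', u i y :=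
    finsum_eq_sum_of_support_subset _ fun i hi =>
      Finset.mem_coe.2 (Finset.mem_union_right _ (hS'' i hi))
  have hcard : ((S ∪ S').card : ℝ) ≤ 2 * N := by
    exact_mod_cast (Finset.card_union_le S S').trans (by omega)
  rw [hx, hy]
  refine (dist_sum_sum_le_of_le _ fun i _ => (hu i).dist_le_mul x y).trans ?_
  rw [Finset.sum_const, nsmul_eq_mul]
  push_cast
  rw [mul_assoc (2 * (N : ℝ))]
  gcongr

/-- Multiplying a `1`-Lipschitz map that vanishes at `c` by a `K`-Lipschitz function with values in
`[-1, 1]` supported in the ball of radius `R` about `c` gives a `(1 + KR)`-Lipschitz map. -/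
theorem lipschitzWith_smul_of_support {X Z : Type*} [PseudoMetricSpace X]
    [SeminormedAddCommGroup Z] [NormedSpace ℝ Z] {χ : X → ℝ} {w : X → Z} {c : X} {K R : ℝ}
    {C : ℝ≥0} (hK : 0 ≤ K) (hχ : ∀ x y, |χ x - χ y| ≤ K * dist x y) (h1 : ∀ x, |χ x| ≤ 1)
    (hs : ∀ x, χ x ≠ 0 → dist x c ≤ R) (hw : LipschitzWith 1 w) (hc : w c = 0)
    (hC : 1 + K * R ≤ C) : LipschitzWith C fun x => χ x • w x := by
  have hw' : ∀ x y, ‖w x - w y‖ ≤ dist x y := fun x y => by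
    simpa [dist_eq_norm] using hw.dist_le_mul x y
  -- The product is split so that `w` is evaluated only at `y`, in the support of `χ`, where `‖w y‖
  -- ≤ R`; the other case follows by symmetry.
  have key : ∀ x y, χ y ≠ 0 → dist (χ x • w x) (χ y • w y) ≤ C * dist x y := fun x y hy => by
    have hwy : ‖w y‖ ≤ R := by
      have := hw' y c
      rw [hc, sub_zero] at this
      exact this.trans (hs y hy)
    have heq : χ x • w x - χ y • w y = χ x • (w x - w y) + (χ x - χ y) • w y := by
      rw [smul_sub, sub_smul]
      abel
    have hd : 0 ≤ dist x y := dist_nonneg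
    rw [dist_eq_norm, heq]
    calc _ ≤ |χ x| * ‖w x - w y‖ + |χ x - χ y| * ‖w y‖ := by
          refine (norm_add_le _ _).trans_eq ?_
          rw [norm_smul, norm_smul, Real.norm_eq_abs, Real.norm_eq_abs]
      _ ≤ 1 * dist x y + K * dist x y * R := by
          gcongr
          exacts [h1 x, hw' x y, hχ x y]
      _ = (1 + K * R) * dist x y := by ring
      _ ≤ _ := by gcongr
  refine LipschitzWith.of_dist_le_mul fun x y => ?_
  by_cases hy : χ y = 0
  · by_cases hx : χ x = 0
    · simp only [hx, hy, zero_smul, dist_self]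
      positivity
    · rw [dist_comm, dist_comm x y]
      exact key y x hx
  · exact key x y hy

end LipschitzSums

/-! ### A dyadic partition of unity on the half-line -/

section Cutoff

/-- The piecewise linear function equal to `1` on `(-∞, 1]` and to `0` on `[2, ∞)`. -/
noncomputable def cutoff (t : ℝ) : ℝ := max 0 (min 1 (2 - t))

theorem cutoff_nonneg (t : ℝ) : 0 ≤ cutoff t := le_max_left _ _

theorem cutoff_le_one (t : ℝ) : cutoff t ≤ 1 := max_le zero_le_one (min_le_left _ _)

theorem cutoff_of_le {t : ℝ} (h : t ≤ 1) : cutoff t = 1 := by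
  rw [cutoff, min_eq_left (by linarith), max_eq_right zero_le_one]

theorem cutoff_of_ge {t : ℝ} (h : 2 ≤ t) : cutoff t = 0 :=
  max_eq_left ((min_le_right _ _).trans (by linarith))

theorem abs_cutoff_sub_le (s t : ℝ) : |cutoff s - cutoff t| ≤ |s - t| := by
  refine (abs_max_sub_max_le_max _ _ _ _).trans (max_le (by simp) ?_)
  refine (abs_min_sub_min_le_max _ _ _ _).trans (max_le (by simp) ?_)
  rw [abs_sub_comm s t]
  exact le_of_eq (congrArg _ (by ring))

/-- A bump supported in `[1/2, 2]` whose dyadic dilates sum to `1`. -/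
noncomputable def bump (t : ℝ) : ℝ := cutoff t - cutoff (2 * t)

theorem abs_bump_le_one (t : ℝ) : |bump t| ≤ 1 := by
  rw [bump, abs_le]
  constructor <;>
    linarith [cutoff_nonneg t, cutoff_nonneg (2 * t), cutoff_le_one t, cutoff_le_one (2 * t)]

theorem abs_bump_sub_le (s t : ℝ) : |bump s - bump t| ≤ 3 * |s - t| := by
  have h1 := abs_cutoff_sub_le s t
  have h2 := abs_cutoff_sub_le (2 * s) (2 * t)
  rw [← mul_sub, abs_mul, abs_two] at h2
  have heq : bump s - bump t = (cutoff s - cutoff t) - (cutoff (2 * s) - cutoff (2 * t)) := by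
    rw [bump, bump]
    ring
  rw [heq]
  linarith [abs_sub (cutoff s - cutoff t) (cutoff (2 * s) - cutoff (2 * t))]

theorem lt_two_of_bump_ne_zero {t : ℝ} (h : bump t ≠ 0) : t < 2 := by
  by_contra! h2
  exact h (by rw [bump, cutoff_of_ge h2, cutoff_of_ge (by linarith), sub_zero])

theorem half_lt_of_bump_ne_zero {t : ℝ} (h : bump t ≠ 0) : 1 < 2 * t := by
  by_contra! h2
  by_cases h1 : t ≤ 1
  · exact h (by rw [bump, cutoff_of_le h1, cutoff_of_le h2, sub_self])
  · linarith

/-- The two scales at which the dyadic dilates of `bump` can be nonzero at `t`. -/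
noncomputable def bumpScales (t : ℝ) : Finset ℤ := {Int.log 2 t, Int.log 2 t + 1}

theorem card_bumpScales_le (t : ℝ) : (bumpScales t).card ≤ 2 := Finset.card_le_two

theorem mem_bumpScales {t : ℝ} {k : ℤ} (h : bump (t / 2 ^ k) ≠ 0) :
    k ∈ bumpScales t := by
  have hk : (0 : ℝ) < 2 ^ k := by positivity
  have h1 := half_lt_of_bump_ne_zero h
  have h2 := lt_two_of_bump_ne_zero h
  rw [div_lt_iff₀ hk] at h2
  rw [← mul_div_assoc, lt_div_iff₀ hk, one_mul] at h1
  have ht' : 0 < t := by linarith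
  have h3 : (2 : ℝ) ^ Int.log 2 t ≤ t := by
    exact_mod_cast Int.zpow_log_le_self (b := 2) one_lt_two ht'
  have h4 : t < (2 : ℝ) ^ (Int.log 2 t + 1) := by
    exact_mod_cast Int.lt_zpow_succ_log_self (b := 2) one_lt_two t
  have h5 : Int.log 2 t < k + 1 := by
    rw [← zpow_lt_zpow_iff_right₀ (one_lt_two (α := ℝ)), zpow_add_one₀ two_ne_zero]
    linarith
  have h6 : k < Int.log 2 t + 1 + 1 := by
    rw [← zpow_lt_zpow_iff_right₀ (one_lt_two (α := ℝ)), zpow_add_one₀ two_ne_zero]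
    linarith
  rw [bumpScales, Finset.mem_insert, Finset.mem_singleton]
  omega

/-- The sum telescopes: with `a = 2 ^ Int.log 2 t`, so `a ≤ t < 2a`, it leaves `cutoff (t / (2a)) -
cutoff (2t / a) = 1 - 0`. -/
theorem sum_bump {t : ℝ} (ht : 0 < t) : ∑ k ∈ bumpScales t, bump (t / 2 ^ k) = 1 := by
  rw [bumpScales, Finset.sum_pair (by omega)]
  have h3 : (2 : ℝ) ^ Int.log 2 t ≤ t := by
    exact_mod_cast Int.zpow_log_le_self (b := 2) one_lt_two ht
  have h4 : t < (2 : ℝ) ^ (Int.log 2 t + 1) := by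
    exact_mod_cast Int.lt_zpow_succ_log_self (b := 2) one_lt_two t
  rw [zpow_add_one₀ two_ne_zero] at h4 ⊢
  set a : ℝ := 2 ^ Int.log 2 t
  have ha : 0 < a := by positivity
  have h5 : 2 * (t / (a * 2)) = t / a := by field_simp
  have h6 : cutoff (2 * (t / a)) = 0 := cutoff_of_ge (by linarith [(one_le_div ha).2 h3])
  have h7 : cutoff (t / (a * 2)) = 1 := cutoff_of_le ((div_le_one (by positivity)).2 h4.le)
  rw [bump, bump, h5, h6, h7]
  ring

end Cutoff

/-! ### The blocks, and the complemented copy of the `ℓ₁`-sum -/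

section Blocks

namespace LipschitzFree

variable {X : Type*} [NormedAddCommGroup X]

/-- The radius of the ball that holds the `k`-th dyadic annulus of the `n`-th copy of `X`, for
`p = (n, k)`. -/
noncomputable def blockRadius (p : ℕ × ℤ) : ℝ := 4 ^ Encodable.encode p

theorem blockRadius_pos (p : ℕ × ℤ) : 0 < blockRadius p := by
  rw [blockRadius]
  positivity

/-- The ratio of the dilation that maps an annulus into its ball. -/
noncomputable def blockScale (p : ℕ × ℤ) : ℝ := blockRadius p / 2 ^ p.2

theorem blockScale_pos (p : ℕ × ℤ) : 0 < blockScale p :=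
  div_pos (blockRadius_pos p) (by positivity)

variable [NormedSpace ℝ X]

/-- The centre of the ball with index `p`; these lie on the line through `e`. -/
noncomputable def blockCenter (e : X) (p : ℕ × ℤ) : X := (16 * blockRadius p) • e

theorem norm_blockCenter {e : X} (he : ‖e‖ = 1) (p : ℕ × ℤ) :
    ‖blockCenter e p‖ = 16 * blockRadius p := by
  rw [blockCenter, norm_smul, he, mul_one, Real.norm_of_nonneg]
  linarith [blockRadius_pos p]

/-- Radii `r < r'` of distinct blocks satisfy `4r ≤ r'`, so the centres are at least `16(r' - r) ≥
4(r + r')` apart and the balls of radius `4r` and `4r'` are disjoint. -/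
theorem eq_of_dist_blockCenter_lt {e : X} (he : ‖e‖ = 1) {y : X} {p q : ℕ × ℤ}
    (hp : dist y (blockCenter e p) < 4 * blockRadius p)
    (hq : dist y (blockCenter e q) < 4 * blockRadius q) : p = q := by
  by_contra hne
  wlog hlt : Encodable.encode p < Encodable.encode q generalizing p q
  · exact this hq hp (Ne.symm hne) (lt_of_le_of_ne (not_lt.1 hlt)
      fun h => hne (Encodable.encode_injective h.symm))
  have h4 : 4 * blockRadius p ≤ blockRadius q := by
    rw [blockRadius, blockRadius, ← pow_succ']
    exact pow_le_pow_right₀ (by norm_num) hlt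
  have hp0 := blockRadius_pos p
  have h1 := norm_sub_norm_le (blockCenter e q) (blockCenter e p)
  rw [norm_blockCenter he, norm_blockCenter he, ← dist_eq_norm] at h1
  linarith [dist_triangle_left (blockCenter e q) (blockCenter e p) y]

/-- The part of `δ_x` at the scale `2 ^ k`, moved to the ball with index `p = (n, k)`. -/
noncomputable def blockIn (e : X) (p : ℕ × ℤ) (x : X) : LipschitzFree X (0 : X) :=
  bump (‖x‖ / 2 ^ p.2) • (blockScale p)⁻¹ •
    (delta 0 (blockCenter e p + blockScale p • x) - delta 0 (blockCenter e p))

/-- The bump has slope at most `3 / 2 ^ k` and lives where `‖x‖ ≤ 2 * 2 ^ k`, giving `1 + 6`.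
Subtracting `δ` at the centre makes the undamped map vanish at `0`. -/
theorem lipschitzWith_blockIn (e : X) (p : ℕ × ℤ) : LipschitzWith 7 (blockIn e p) := by
  have h2 : (0 : ℝ) < 2 ^ p.2 := by positivity
  have hs := blockScale_pos p
  refine lipschitzWith_smul_of_support (c := 0) (K := 3 / 2 ^ p.2) (R := 2 * 2 ^ p.2)
    (by positivity) (fun x y => ?_) (fun x => abs_bump_le_one _) (fun x hx => ?_) ?_ (by simp) ?_
  · refine (abs_bump_sub_le _ _).trans ?_
    rw [← sub_div, abs_div, abs_of_pos h2, div_mul_eq_mul_div, ← mul_div_assoc, dist_eq_norm]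
    gcongr
    exact abs_norm_sub_norm_le x y
  · rw [dist_zero_right, ← div_le_iff₀ h2]
    exact (lt_two_of_bump_ne_zero hx).le
  · refine LipschitzWith.of_dist_le_mul fun x y => ?_
    have h := lipschitzWith_delta (o := (0 : X)).dist_le_mul
      (blockCenter e p + blockScale p • x) (blockCenter e p + blockScale p • y)
    rw [dist_add_left, dist_smul₀, Real.norm_of_nonneg hs.le] at h
    rw [dist_smul₀, dist_sub_right, norm_inv, Real.norm_of_nonneg hs.le, inv_mul_le_iff₀ hs]
    simpa using h
  · have : 3 / (2 : ℝ) ^ p.2 * (2 * 2 ^ p.2) = 6 := by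
      field_simp
      norm_num
    rw [this]
    norm_num

theorem mem_bumpScales_of_blockIn_ne_zero {e : X} {n : ℕ} {k : ℤ} {x : X}
    (h : blockIn e (n, k) x ≠ 0) : k ∈ bumpScales ‖x‖ :=
  mem_bumpScales fun h0 => h (by rw [blockIn, h0, zero_smul])

/-- The part of `δ_y` in the ball with index `p = (n, k)`, moved to the `n`-th coordinate. -/
noncomputable def blockOut (e : X) (p : ℕ × ℤ) (y : X) :
    lp (fun _ : ℕ => LipschitzFree X (0 : X)) 1 :=
  cutoff (dist y (blockCenter e p) / (2 * blockRadius p)) •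
    lp.inj ℕ (LipschitzFree X (0 : X)) p.1
      (blockScale p • delta 0 ((blockScale p)⁻¹ • (y - blockCenter e p)))

theorem dist_lt_of_cutoff_ne_zero {e y : X} {p : ℕ × ℤ}
    (h : cutoff (dist y (blockCenter e p) / (2 * blockRadius p)) ≠ 0) :
    dist y (blockCenter e p) < 4 * blockRadius p := by
  have hr := blockRadius_pos p
  by_contra! h4
  refine h (cutoff_of_ge ?_)
  rw [le_div_iff₀ (by positivity)]
  linarith

theorem dist_lt_of_blockOut_ne_zero {e y : X} {p : ℕ × ℤ} (h : blockOut e p y ≠ 0) :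
    dist y (blockCenter e p) < 4 * blockRadius p :=
  dist_lt_of_cutoff_ne_zero fun h0 => h (by rw [blockOut, h0, zero_smul])

/-- The cutoff has slope at most `1 / (2r)` and lives in the ball of radius `4r`, giving `1 + 2`. -/
theorem lipschitzWith_blockOut (e : X) (p : ℕ × ℤ) : LipschitzWith 3 (blockOut e p) := by
  have hr := blockRadius_pos p
  have hs := blockScale_pos p
  refine lipschitzWith_smul_of_support (c := blockCenter e p) (K := 1 / (2 * blockRadius p))
    (R := 4 * blockRadius p) (by positivity) (fun x y => ?_)
    (fun x => by rw [abs_of_nonneg (cutoff_nonneg _)]; exact cutoff_le_one _)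
    (fun x hx => (dist_lt_of_cutoff_ne_zero hx).le) ?_ (by simp [delta_base]) ?_
  · refine (abs_cutoff_sub_le _ _).trans ?_
    rw [← sub_div, abs_div, abs_of_pos (by positivity : 0 < 2 * blockRadius p),
      div_mul_eq_mul_div, one_mul]
    gcongr
    exact abs_dist_sub_le _ _ _
  · refine LipschitzWith.of_dist_le_mul fun x y => ?_
    have h := lipschitzWith_delta (o := (0 : X)).dist_le_mul
      ((blockScale p)⁻¹ • (x - blockCenter e p)) ((blockScale p)⁻¹ • (y - blockCenter e p))
    rw [dist_smul₀, dist_sub_right, norm_inv, Real.norm_of_nonneg hs.le, NNReal.coe_one, one_mul,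
      ← div_eq_inv_mul, le_div_iff₀ hs, mul_comm] at h
    have hinj : Isometry (lp.inj ℕ (LipschitzFree X (0 : X)) p.1) :=
      lp.isometry_single (E := fun _ : ℕ => LipschitzFree X (0 : X)) p.1
    rw [hinj.dist_eq, dist_smul₀, Real.norm_of_nonneg hs.le]
    simpa using h
  · have : 1 / (2 * blockRadius p) * (4 * blockRadius p) = 2 := by
      field_simp
      norm_num
    rw [this]
    norm_num

theorem blockOut_zero {e : X} (he : ‖e‖ = 1) (p : ℕ × ℤ) : blockOut e p 0 = 0 := by
  by_contra h
  have := dist_lt_of_blockOut_ne_zero h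
  rw [dist_zero_left, norm_blockCenter he] at this
  linarith [blockRadius_pos p]

/-- The dilated point is within `2r` of its centre, where the cutoff is `1`; disjointness kills
every other block. -/
theorem finsum_blockOut {e : X} (he : ‖e‖ = 1) {p : ℕ × ℤ} {x : X} (hx : ‖x‖ ≤ 2 * 2 ^ p.2) :
    ∑ᶠ q, blockOut e q (blockCenter e p + blockScale p • x)
      = blockScale p • lp.inj ℕ (LipschitzFree X (0 : X)) p.1 (delta 0 x) := by
  have hr := blockRadius_pos p
  have hs := blockScale_pos p
  have hdist : dist (blockCenter e p + blockScale p • x) (blockCenter e p)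
      ≤ 2 * blockRadius p := by
    rw [dist_self_add_left, norm_smul, Real.norm_of_nonneg hs.le]
    calc _ ≤ blockScale p * (2 * 2 ^ p.2) := by gcongr
      _ = _ := by
        rw [blockScale]
        field_simp
  rw [finsum_eq_single _ p fun q hq => ?_]
  · rw [blockOut, cutoff_of_le ((div_le_one (by positivity)).2 hdist), one_smul,
      add_sub_cancel_left, inv_smul_smul₀ hs.ne', map_smul]
  · by_contra h
    exact hq (eq_of_dist_blockCenter_lt he (dist_lt_of_blockOut_ne_zero h) (by linarith))

/-- `ℓ₁(F(X))` is isomorphic to a complemented subspace of `F(X)`. -/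
theorem exists_comp_eq_id [Nontrivial X] :
    ∃ (P : LipschitzFree X (0 : X) →L[ℝ] lp (fun _ : ℕ => LipschitzFree X (0 : X)) 1)
      (J : lp (fun _ : ℕ => LipschitzFree X (0 : X)) 1 →L[ℝ] LipschitzFree X (0 : X)),
      P.comp J = ContinuousLinearMap.id ℝ _ := by
  obtain ⟨e, he⟩ := exists_norm_eq X zero_le_one
  have hIn : ∀ n : ℕ, LipschitzWith (2 * (2 : ℕ) * 7) fun x => ∑ᶠ k : ℤ, blockIn e (n, k) x := fun n =>
    LipschitzWith.finsum_of_card_support_le (fun k : ℤ => lipschitzWith_blockIn e (n, k)) fun x =>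
      ⟨bumpScales ‖x‖, card_bumpScales_le _, fun k => mem_bumpScales_of_blockIn_ne_zero⟩
  have hIn0 : ∀ n : ℕ, ∑ᶠ k : ℤ, blockIn e (n, k) 0 = 0 := fun n => by simp [blockIn]
  choose T hT hTdelta using fun n => exists_lift (hIn n) (hIn0 n)
  obtain ⟨J, hJ⟩ := lp.exists_lift_of_one hT
  have hOut : LipschitzWith (2 * (1 : ℕ) * 3) fun y => ∑ᶠ p, blockOut e p y :=
    LipschitzWith.finsum_of_card_support_le (lipschitzWith_blockOut e) fun y => by
      by_cases h : ∃ p, blockOut e p y ≠ 0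
      · obtain ⟨p, hp⟩ := h
        exact ⟨{p}, by simp, fun q hq => Finset.mem_singleton.2 (eq_of_dist_blockCenter_lt he
          (dist_lt_of_blockOut_ne_zero hq) (dist_lt_of_blockOut_ne_zero hp))⟩
      · push Not at h
        exact ⟨∅, by simp, fun q hq => (hq (h q)).elim⟩
  obtain ⟨P, -, hP⟩ := exists_lift hOut (finsum_eq_zero_of_forall_eq_zero (blockOut_zero he))
  refine ⟨P, J, lp.clm_ext_of_one fun n => clm_ext fun x => ?_⟩
  have hblock : ∀ k : ℤ, P (blockIn e (n, k) x)
      = bump (‖x‖ / 2 ^ k) • lp.inj ℕ (LipschitzFree X (0 : X)) n (delta 0 x) := fun k => by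
    by_cases hk : bump (‖x‖ / 2 ^ k) = 0
    · rw [blockIn, hk, zero_smul, zero_smul, map_zero]
    · have hx := (lt_two_of_bump_ne_zero hk).le
      rw [div_le_iff₀ (by positivity)] at hx
      -- `P` kills `δ` at each centre, so the correction term in `blockIn` does not affect `P ∘ J`.
      have hc := finsum_blockOut he (p := (n, k)) (x := 0) (by rw [norm_zero]; positivity)
      rw [smul_zero, add_zero, delta_base, map_zero, smul_zero] at hc
      rw [blockIn, map_smul, map_smul, map_sub, hP, hP, hc, finsum_blockOut he hx, sub_zero,
        inv_smul_smul₀ (blockScale_pos _).ne']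
  have hJx : J (lp.inj ℕ (LipschitzFree X (0 : X)) n (delta 0 x))
      = ∑ k ∈ bumpScales ‖x‖, blockIn e (n, k) x := by
    rw [← finsum_eq_sum_of_support_subset _ fun k hk => mem_bumpScales_of_blockIn_ne_zero hk,
      ← hTdelta, ← hJ n]
    rfl
  change P (J (lp.inj ℕ (LipschitzFree X (0 : X)) n (delta 0 x)))
    = lp.inj ℕ (LipschitzFree X (0 : X)) n (delta 0 x)
  rw [hJx, map_sum, Finset.sum_congr rfl fun k _ => hblock k, ← Finset.sum_smul]
  -- The bumps do not sum to `1` at the origin, but `δ_0 = 0`.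
  rcases eq_or_ne x 0 with rfl | hx
  · rw [delta_base, map_zero, smul_zero]
  · rw [sum_bump (norm_pos_iff.2 hx), one_smul]

theorem subsingleton_of_subsingleton {M : Type*} [MetricSpace M] [Subsingleton M] (o : M) :
    Subsingleton (LipschitzFree M o) := by
  have h : ContinuousLinearMap.id ℝ (LipschitzFree M o) = 0 := clm_ext fun x => by
    rw [Subsingleton.elim x o, delta_base, map_zero, map_zero]
  refine ⟨fun a b => ?_⟩
  exact (DFunLike.congr_fun h a).trans (DFunLike.congr_fun h b).symm

end LipschitzFree

end Blocks

theorem theorem3p1 (X : Type*) [NormedAddCommGroup X] [NormedSpace ℝ X] [CompleteSpace X] :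
    Nonempty (LipschitzFree X (0 : X) ≃L[ℝ] lp (fun _ : ℕ => LipschitzFree X (0 : X)) 1) := by
  rcases subsingleton_or_nontrivial X with hX | hX
  · have := LipschitzFree.subsingleton_of_subsingleton (0 : X)
    -- There is no unit vector here, but `F(X) = 0`, so zero operators serve as `P` and `J`.
    refine lp.nonempty_equiv_of_complemented 0 0 (lp.clm_ext_of_one fun n => ?_)
    ext1 γ
    rw [Subsingleton.elim γ 0, map_zero, map_zero]
  · obtain ⟨P, J, h⟩ := LipschitzFree.exists_comp_eq_id (X := X)
    exact lp.nonempty_equiv_of_complemented P J h
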